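/- **Proposition 4.3 (Equivariant exactness criterion).** Let a group $G_0$ act linearly on $\mathfrak g_1=\mathbb A^N_{\mathbb C}$ with finitely many orbits $\mathcal O_0,\dots,\mathcal O_t$ (for instance, $\mathfrak g_1$ is the degree-one part of a complex simple Lie algebra graded by a distinguished node of its Dynkin diagram, with the natural group acting). Let $p_j$ be a representative of $\mathcal O_j$, and let $p$ be a representative of the generic orbit, i.e. of a Zariski dense orbit. Let $A=\mathbb C[\mathfrak g_1]=\mathbb C[x_1,\dots,x_N]$ with its standard grading and the induced $G_0$-action $(g\cdot f)(v)=f(g^{-1}v)$. Let $$F_\bullet:\quad 0\leftarrow F_0\xleftarrow{d_1}F_1\leftarrow\cdots\leftarrow F_{n-1}\xleftarrow{d_n}F_n\leftarrow 0$$ be a $G_0$-equivariant minimal complex of graded free $A$-modules of finite rank. That is, each $F_k$ carries a degree-preserving additive $G_0$-action with $g(fx)=(g\cdot f)(gx)$ for $f\in A$, $x\in F_k$; the differentials have degree $0$ and commute with $G_0$; and $d_k(F_k)\subseteq(x_1,\dots,x_N)F_{k-1}$ for all $k$. Assume that $d_k\neq 0$ for $k=1,\dots,n$, and put $d_{n+1}=0$.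 For $q\in\mathfrak g_1$ let $d_k|_q$ be the $\mathbb C$-linear map obtained from $d_k$ by base change along the evaluation $A\to\mathbb C$ at $q$. Then $F_\bullet$ is exact in positive degrees (that is, $H_k(F_\bullet)=0$ for all $k\ge 1$) if and only if for all $k=1,\dots,n$: 1. $\operatorname{rank}(F_k)=\operatorname{rank}(d_k|_p)+\operatorname{rank}(d_{k+1}|_p)$; 2. $\min\{\operatorname{codim}(\overline{\mathcal O}_j)\mid \operatorname{rank}(d_k|_{p_j})<\operatorname{rank}(d_k|_p)\}\ge k$, where $\overline{\mathcal O}_j$ is the Zariski closure of $\mathcal O_j$ and $\operatorname{codim}$ is its codimension in $\mathfrak g_1$. -/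

import Mathlib

open CategoryTheory

universe u

/-- The coordinate ring `A = ℂ[x₁, …, x_N]` of the affine space `ℂ ^ N`. -/
abbrev CoordRing (N : ℕ) : Type := MvPolynomial (Fin N) ℂ

/-- The irrelevant maximal ideal `(x₁, …, x_N)` of `A`. -/
noncomputable def irrelevantIdeal (N : ℕ) : Ideal (CoordRing N) :=
  Ideal.span (Set.range (MvPolynomial.X : Fin N → CoordRing N))

section Orbits

variable {N : ℕ} {G : Type*} [Group G] (ρ : Representation ℂ G (Fin N → ℂ))

/-- The action of `g ∈ G` on `A` induced by the linear action on `ℂ ^ N`,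
namely `(g • f) v = f (g⁻¹ • v)`; on variables it is `x_i ↦ ∑_j (ρ g⁻¹)_{ij} x_j`. -/
noncomputable def coordAct (g : G) : CoordRing N →ₐ[ℂ] CoordRing N :=
  MvPolynomial.aeval fun i : Fin N =>
    ∑ j : Fin N, MvPolynomial.C (ρ g⁻¹ (Pi.single j 1) i) * MvPolynomial.X j

/-- The defining property of the induced action on polynomial functions. -/
theorem eval_coordAct (g : G) (f : CoordRing N) (v : Fin N → ℂ) :
    MvPolynomial.eval v (coordAct ρ g f) = MvPolynomial.eval (ρ g⁻¹ v) f := by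
  have key : ∀ i : Fin N,
      ∑ j : Fin N, ρ g⁻¹ (Pi.single j 1) i * v j = ρ g⁻¹ v i := by
    intro i
    have h := congrFun (LinearMap.pi_apply_eq_sum_univ (ρ g⁻¹) v) i
    rw [h, Finset.sum_apply]
    refine Finset.sum_congr rfl fun j _ => ?_
    have e : (Pi.single j 1 : Fin N → ℂ) = fun l => if j = l then 1 else 0 := by
      funext l
      simp [Pi.single_apply, eq_comm]
    rw [e, Pi.smul_apply, smul_eq_mul, mul_comm]
  induction f using MvPolynomial.induction_on with
  | C a => simp [coordAct]
  | add p q hp hq => simp [hp, hq]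
  | mul_X p i hp =>
    rw [map_mul, map_mul, hp, map_mul]
    congr 1
    simp [coordAct, key]

/-- The orbit of a point `v`. -/
def orbitOf (v : Fin N → ℂ) : Set (Fin N → ℂ) := Set.range fun g : G => ρ g v

end Orbits

section Zariski

variable {N : ℕ}

/-- The Zariski closure of a subset of `ℂ ^ N`. -/
def zariskiClosure (S : Set (Fin N → ℂ)) : Set (Fin N → ℂ) :=
  MvPolynomial.zeroLocus ℂ (MvPolynomial.vanishingIdeal ℂ S)

/-- The codimension in `ℂ ^ N` of a (Zariski closed) set: the height of its ideal. -/
noncomputable def codim (Z : Set (Fin N → ℂ)) : ℕ∞ :=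
  (MvPolynomial.vanishingIdeal ℂ Z).height

/-- The rank of `d|_q`, where `d|_q` is the `ℂ`-linear map `ℂ ⊗_A M → ℂ ⊗_A M'` obtained from
`d` by base change along the evaluation `A → ℂ` at the point `q`. -/
noncomputable def rankAt {M M' : Type*} [AddCommGroup M] [Module (CoordRing N) M]
    [AddCommGroup M'] [Module (CoordRing N) M'] (d : M →ₗ[CoordRing N] M')
    (q : Fin N → ℂ) : ℕ :=
  letI : Algebra (CoordRing N) ℂ := (MvPolynomial.eval q).toAlgebra
  Module.finrank ℂ (LinearMap.range (d.baseChange ℂ))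

end Zariski

/-- `gr` makes `M` a `ℤ`-graded `A`-module (for the standard grading of `A`) that is graded free
of finite rank, i.e. has a finite basis of homogeneous elements. -/
structure IsGradedFree (N : ℕ) {M : Type*} [AddCommGroup M] [Module (CoordRing N) M]
    (gr : ℤ → AddSubgroup M) : Prop where
  isInternal : DirectSum.IsInternal gr
  smul_mem : ∀ (m : ℕ) (e : ℤ) (f : CoordRing N) (x : M),
    f.IsHomogeneous m → x ∈ gr e → f • x ∈ gr (m + e)
  exists_basis : ∃ (r : ℕ) (b : Module.Basis (Fin r) (CoordRing N) M),
    ∀ i, ∃ e, b i ∈ gr e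


/-- A `G`-equivariant complex `0 ← F₀ ← F₁ ← ⋯ ← F_n ← 0` of graded free `A`-modules of finite
rank. Each `F_k` carries a degree-preserving action of `G` compatible with the action on `A`;
the differentials have degree `0` and commute with `G`. -/
structure EquivariantComplex {N : ℕ} {G : Type*} [Group G]
    (ρ : Representation ℂ G (Fin N → ℂ)) (n : ℕ) where
  /-- the underlying complex of `A`-modules -/
  cx : ChainComplex (ModuleCat.{u} (CoordRing N)) ℕ
  /-- the graded pieces of the terms -/
  gr : ∀ k, ℤ → AddSubgroup (cx.X k)
  gradedFree : ∀ k, IsGradedFree N (gr k)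
  isZero : ∀ k, n < k → Limits.IsZero (cx.X k)
  d_mem : ∀ (i j : ℕ) (e : ℤ) (x : cx.X i), x ∈ gr i e → (cx.d i j).hom x ∈ gr j e
  /-- the action of `G` on the terms -/
  act : ∀ k, G →* AddMonoid.End (cx.X k)
  act_smul : ∀ (k : ℕ) (g : G) (f : CoordRing N) (x : cx.X k),
    act k g (f • x) = coordAct ρ g f • act k g x
  act_mem : ∀ (k : ℕ) (g : G) (e : ℤ) (x : cx.X k), x ∈ gr k e → act k g x ∈ gr k e
  d_act : ∀ (i j : ℕ) (g : G) (x : cx.X i),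
    (cx.d i j).hom (act i g x) = act j g ((cx.d i j).hom x)

namespace EquivariantComplex

variable {N : ℕ} {G : Type*} [Group G] {ρ : Representation ℂ G (Fin N → ℂ)} {n : ℕ}

/-- The differential `d_k : F_k → F_{k-1}` (used for `k ≥ 1`). -/
noncomputable def diff (F : EquivariantComplex.{u} ρ n) (k : ℕ) :
    F.cx.X k →ₗ[CoordRing N] F.cx.X (k - 1) :=
  (F.cx.d k (k - 1)).hom

/-- The complex is minimal: `d_k(F_k) ⊆ (x₁, …, x_N) F_{k-1}` for all `k ≥ 1`. -/
def IsMinimal (F : EquivariantComplex.{u} ρ n) : Prop :=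
  ∀ k, 1 ≤ k → LinearMap.range (F.diff k) ≤
    irrelevantIdeal N • (⊤ : Submodule (CoordRing N) (F.cx.X (k - 1)))

/-- Exactness, in the sense of resolutions: the homology at `F_k` vanishes for all `k ≥ 1`
(in particular `d_n` is injective). -/
def IsExact (F : EquivariantComplex.{u} ρ n) : Prop :=
  ∀ k, 1 ≤ k → F.cx.ExactAt k

end EquivariantComplex

/-! This is the Buchsbaum–Eisenbud criterion, with ranks over residue fields in place of grades of
ideals of minors. Write `D k` for the matrix of `d_{k+1}`. Depth enters only through
`HasRegularChains`: a prime `P` of height `h` in a polynomial ring is, locally, generated by a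
regular sequence of length `h`.

Suppose the complex is exact. Dividing by one regular element costs one degree of exactness, so over
the residue field of `P` the complex stays exact in degrees above `h` (`RegularChain.locallyExact`).
Counting dimensions down from the end of the complex shows that `D k` keeps its generic rank at
every prime of height at most `k` (`MatrixExact.residueRank_eq`).

Conversely (`MatrixExact.of_residueRank`), a homology class yields an associated prime `P` of the
cokernel of the next differential. It is nonzero because the complex is generically exact. By
constancy of rank the maps `D j` with `j ≥ h` split at `P`, so the cokernel has projective dimension
less than `h` there, and `P` cannot be associated (`RegularChain.exists_smul_mem_range`, a form of
Auslander–Buchsbaum).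

Equivariance makes pointwise ranks constant on orbits. The dense orbit sees the generic rank, and
the Nullstellensatz finds on the zero locus of `P` a point outside the finitely many orbits of
codimension greater than the height of `P` (`IsOrbitInvariant.exists_le_pointRank`). -/

/-! ### Primes of polynomial rings are locally generated by regular sequences. -/

section RegularChain

open Polynomial

/-- `RegularChain P h J` says that, locally at `P`, the ideal `P` is generated modulo `J` by a
sequence of `h` elements of `P` that is regular on `A ⧸ J`. The localization is spelled out
with denominators outside `P`. -/
inductive RegularChain {R : Type*} [CommRing R] (P : Ideal R) : ℕ → Ideal R → Prop
  | refl : RegularChain P 0 P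
  | step {h : ℕ} {J J' : Ideal R} (x : R) (hx : x ∈ P) (hreg : ∀ a, x * a ∈ J → a ∈ J)
      (hJ : J ≤ J') (hxJ : x ∈ J') (hloc : ∀ a ∈ J', ∃ s ∉ P, ∃ b, s * a - x * b ∈ J)
      (hc : RegularChain P h J') : RegularChain P (h + 1) J

variable {R S : Type*} [CommRing R] [CommRing S]

theorem RegularChain.comap_equiv (e : R ≃+* S) {P J : Ideal S} {h : ℕ} (hc : RegularChain P h J) :
    RegularChain (P.comap e) h (J.comap e) := by
  induction hc with
  | refl => exact .refl
  | @step h J J' x hx hreg hJ hxJ hloc hc ih =>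
    refine .step (e.symm x) (by rw [Ideal.mem_comap]; simpa only [e.apply_symm_apply]) (fun a ha => ?_)
      (Ideal.comap_mono hJ)
      (by rw [Ideal.mem_comap]; simpa only [e.apply_symm_apply]) (fun a ha => ?_) ih
    · exact hreg _ (by simpa using ha)
    · obtain ⟨s, hs, b, hb⟩ := hloc (e a) ha
      exact ⟨e.symm s, by rw [Ideal.mem_comap]; simpa only [e.apply_symm_apply], e.symm b, by simpa using hb⟩

/-- A common denominator for finitely many membership statements. -/
theorem exists_common_denominator {P J J' : Ideal R} [P.IsPrime] {x : R}
    (hloc : ∀ a ∈ J', ∃ s ∉ P, ∃ b, s * a - x * b ∈ J) {ι : Type*} (t : Finset ι) (v : ι → R)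
    (hv : ∀ i ∈ t, v i ∈ J') : ∃ s ∉ P, ∃ w : ι → R, ∀ i ∈ t, s * v i - x * w i ∈ J := by
  classical
  have h : ∀ i, ∃ s ∉ P, ∃ b, i ∈ t → s * v i - x * b ∈ J := fun i => by
    by_cases hi : i ∈ t
    · obtain ⟨s, hs, b, hb⟩ := hloc _ (hv i hi)
      exact ⟨s, hs, b, fun _ => hb⟩
    · exact ⟨1, (Ideal.ne_top_iff_one P).1 Ideal.IsPrime.ne_top', 0, fun h => (hi h).elim⟩
  choose s hs b hb using h
  refine ⟨∏ i ∈ t, s i, fun hmem => ?_, fun i => (∏ j ∈ t.erase i, s j) * b i, fun i hi => ?_⟩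
  · obtain ⟨i, -, hi⟩ := Ideal.IsPrime.prod_mem_iff.1 hmem
    exact hs i hi
  · rw [← Finset.mul_prod_erase t s hi]
    have := J.mul_mem_left (∏ j ∈ t.erase i, s j) (hb i hi)
    convert this using 1
    ring

/-- Regularity and local generation pass to `R[X]` coefficient by coefficient; a polynomial has
finitely many coefficients, so one denominator serves them all. -/
theorem RegularChain.append_map_C {Q J : Ideal R} [Q.IsPrime] {h h' : ℕ} (hc : RegularChain Q h J)
    {P : Ideal R[X]} (hP : P.comap C = Q) (hlast : RegularChain P h' (Q.map C)) :
    RegularChain P (h + h') (J.map C) := by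
  have hCP : ∀ a, C a ∈ P ↔ a ∈ Q := fun a => by rw [← hP, Ideal.mem_comap]
  induction hc with
  | refl => simpa using hlast
  | @step h J J' x hx hreg hJ hxJ hloc hc ih =>
    rw [Nat.add_right_comm]
    refine .step (C x) ((hCP x).2 hx) (fun a ha => ?_) (Ideal.map_mono hJ)
      (Ideal.mem_map_of_mem _ hxJ) (fun a ha => ?_) ih
    · rw [Ideal.mem_map_C_iff] at ha ⊢
      exact fun n => hreg _ (by simpa using ha n)
    · rw [Ideal.mem_map_C_iff] at ha
      obtain ⟨s, hs, w, hw⟩ := exists_common_denominator hloc a.support a.coeff fun i _ => ha i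
      refine ⟨C s, fun h => hs ((hCP s).1 h), ∑ i ∈ a.support, monomial i (w i), ?_⟩
      rw [Ideal.mem_map_C_iff]
      intro n
      by_cases hn : n ∈ a.support
      · simpa [finsetSum_coeff, coeff_monomial, Polynomial.mem_support_iff.1 hn] using hw n hn
      · simp [finsetSum_coeff, coeff_monomial, Polynomial.notMem_support_iff.1 hn]

/-- A prime of `R[X]` that is not extended from its contraction `Q` to `R` is, locally and modulo
`Q`, generated by one polynomial. -/
theorem exists_generator_mod_map_C {P : Ideal R[X]} [hPp : P.IsPrime]
    (hne : ¬ P ≤ (P.comap C).map C) :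
    ∃ g ∈ P, g ∉ (P.comap C).map C ∧
      ∀ a ∈ P, ∃ s ∉ P, ∃ b, s * a - g * b ∈ (P.comap C).map C := by
  set Q := P.comap C with hQ
  have hQP : Q.map C ≤ P := Ideal.map_comap_le
  obtain ⟨g₀, hg₀, hg₀Q⟩ := SetLike.not_le_iff_exists.1 hne
  have hex : ∃ n, ∃ g ∈ P, g ∉ Q.map C ∧ g.natDegree = n := ⟨_, g₀, hg₀, hg₀Q, rfl⟩
  classical
  -- The generator is an element of least degree in `P` outside the extension of `Q`.
  obtain ⟨g, hgP, hgQ, hgn⟩ := Nat.find_spec hex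
  set n := Nat.find hex
  have hmin : ∀ a ∈ P, a.natDegree < n → a ∈ Q.map C := fun a ha hlt => by
    by_contra hn
    exact Nat.find_min hex hlt ⟨a, ha, hn, rfl⟩
  have hn0 : n ≠ 0 := fun h0 => by
    rw [h0] at hgn
    rw [eq_C_of_natDegree_eq_zero hgn] at hgP hgQ
    exact hgQ (Ideal.mem_map_of_mem _ hgP)
  -- Otherwise the leading term could be dropped, giving such an element of smaller degree.
  have hlead : C g.leadingCoeff ∉ P := fun hmem => by
    have h1 : C g.leadingCoeff * X ^ g.natDegree ∈ Q.map C :=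
      Ideal.mul_mem_right _ _ (Ideal.mem_map_of_mem _ hmem)
    have h2 : g.eraseLead ∈ Q.map C := by
      apply hmin
      · rw [← self_sub_C_mul_X_pow]
        exact P.sub_mem hgP (hQP h1)
      · have := eraseLead_natDegree_le g
        omega
    exact hgQ (by rw [← eraseLead_add_C_mul_X_pow g]; exact Ideal.add_mem _ h2 h1)
  refine ⟨g, hgP, hgQ, ?_⟩
  suffices H : ∀ N, ∀ a ∈ P, a.natDegree < n + N → ∃ s ∉ P, ∃ b, s * a - g * b ∈ Q.map C from
    fun a ha => H (a.natDegree + 1) a ha (by omega)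
  intro N
  induction N with
  | zero =>
    intro a ha hlt
    exact ⟨1, (Ideal.ne_top_iff_one P).1 hPp.ne_top, 0, by simpa using hmin a ha hlt⟩
  | succ N ih =>
    intro a ha hlt
    -- Pseudo-division by `g`: the coefficients of degree `n + N` cancel, and the leading
    -- coefficient of `g` is an allowed denominator.
    set a' := C g.leadingCoeff * a - g * (C (a.coeff (n + N)) * X ^ N) with ha'
    have hd : a'.natDegree < n + N := by
      suffices h : a'.natDegree ≤ n + N - 1 by omega
      rw [natDegree_le_iff_coeff_eq_zero]
      intro m hm
      replace hm : n + N ≤ m := by omega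
      rw [ha', ← mul_assoc, coeff_sub, coeff_C_mul, coeff_mul_X_pow', if_pos (by omega),
        coeff_mul_C]
      rcases hm.eq_or_lt with rfl | hm
      · rw [Nat.add_sub_cancel, leadingCoeff, hgn]
        ring
      · rw [coeff_eq_zero_of_natDegree_lt (show a.natDegree < m by omega),
          coeff_eq_zero_of_natDegree_lt (show g.natDegree < m - N by omega)]
        ring
    obtain ⟨s, hs, b, hb⟩ := ih a' (P.sub_mem (P.mul_mem_left _ ha) (P.mul_mem_right _ hgP)) hd
    refine ⟨s * C g.leadingCoeff, fun h => (hPp.mem_or_mem h).elim hs hlead,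
      b + s * (C (a.coeff (n + N)) * X ^ N), ?_⟩
    convert hb using 1
    rw [ha']
    ring

/-- Every prime is locally generated by a regular sequence whose length is the height. -/
def HasRegularChains (R : Type*) [CommRing R] : Prop :=
  ∀ P : Ideal R, P.IsPrime → ∃ h : ℕ, P.height = h ∧ RegularChain P h ⊥

theorem HasRegularChains.of_ringEquiv (e : R ≃+* S) (H : HasRegularChains S) :
    HasRegularChains R := by
  intro P hP
  have hP' : (P.comap e.symm).IsPrime := Ideal.comap_isPrime _ _
  obtain ⟨h, hh, hc⟩ := H _ hP'
  refine ⟨h, by rwa [e.symm.height_comap] at hh, ?_⟩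
  have := hc.comap_equiv e
  rw [show (P.comap e.symm).comap e = P by ext; simp] at this
  rwa [show (⊥ : Ideal S).comap e = ⊥ by ext; simp] at this

theorem HasRegularChains.of_field (K : Type*) [Field K] : HasRegularChains K := by
  intro P hP
  obtain rfl : P = ⊥ := (Ideal.eq_bot_or_top P).resolve_right hP.ne_top
  exact ⟨0, by simp, .refl⟩

theorem height_map_C_of_isPrime [IsNoetherianRing R] (Q : Ideal R) [Q.IsPrime] :
    (Q.map C).height = Q.height := by
  have hp : (Q.map (C : R →+* R[X])).IsPrime := Ideal.isPrime_map_C_of_isPrime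
  have : (Q.map (C : R →+* R[X])).LiesOver Q := ⟨by
    ext a
    simp only [Ideal.under_def, Ideal.mem_comap, algebraMap_eq, Ideal.mem_map_C_iff, coeff_C]
    refine ⟨fun h n => by split_ifs <;> simp [h], fun h => by simpa using h 0⟩⟩
  rw [Ideal.height_eq_height_add_of_liesOver_of_hasGoingDown Q, algebraMap_eq,
    Ideal.map_quotient_self]
  simp

/-- Either `P` is extended from its contraction, with the same height and chain, or one more
generator is needed and the height grows by exactly one. -/
theorem HasRegularChains.polynomial [IsNoetherianRing R] (H : HasRegularChains R) :
    HasRegularChains R[X] := by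
  intro P hP
  have hQ : (P.comap C).IsPrime := Ideal.comap_isPrime C P
  have hQX : ((P.comap C).map C).IsPrime := Ideal.isPrime_map_C_of_isPrime
  have hQP : (P.comap C).map C ≤ P := Ideal.map_comap_le
  obtain ⟨h, hh, hc⟩ := H _ hQ
  by_cases hle : P ≤ (P.comap C).map C
  · have heq := le_antisymm hQP hle
    refine ⟨h, ?_, ?_⟩
    · rw [← hh, ← height_map_C_of_isPrime (P.comap C), heq]
    · have := hc.append_map_C (P := P) rfl (h' := 0) (by rw [heq]; exact .refl)
      rwa [Ideal.map_bot] at this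
  · obtain ⟨g, hgP, hgQ, hg⟩ := exists_generator_mod_map_C hle
    refine ⟨h + 1, le_antisymm ?_ ?_, ?_⟩
    · have : P.LiesOver (P.comap C) := ⟨rfl⟩
      refine (Ideal.height_le_height_add_of_liesOver (P.comap C) P).trans ?_
      rw [hh, Nat.cast_add, Nat.cast_one]
      gcongr
      set q := Ideal.Quotient.mk ((P.comap C).map (algebraMap R R[X])) with hq
      have hker : RingHom.ker q ≤ P := by rw [hq, Ideal.mk_ker]; exact hQP
      have hsurj : Function.Surjective q := Ideal.Quotient.mk_surjective
      -- Krull's principal ideal theorem: modulo the extension of the contraction, `P` is minimal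
      -- over `g`, because `g` generates it locally.
      refine Ideal.height_le_one_of_isPrincipal_of_mem_minimalPrimes (Ideal.span {q g}) _
        ⟨⟨Ideal.map_isPrime_of_surjective hsurj hker, ?_⟩, ?_⟩
      · rw [Ideal.span_singleton_le_iff_mem]
        exact Ideal.mem_map_of_mem _ hgP
      · rintro p' ⟨hp', hgp'⟩ hp'P
        rw [Ideal.span_singleton_le_iff_mem] at hgp'
        rw [Ideal.map_le_iff_le_comap]
        intro a ha
        obtain ⟨s, hs, b, hb⟩ := hg a ha
        have h0 : q s * q a = q g * q b := by
          rw [← map_mul, ← map_mul, ← sub_eq_zero, ← map_sub, hq, Ideal.Quotient.eq_zero_iff_mem]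
          exact hb
        have hmem : q s * q a ∈ p' := h0 ▸ p'.mul_mem_right _ hgp'
        refine (hp'.mem_or_mem hmem).resolve_left fun hsp => hs ?_
        obtain ⟨s', hs', hss⟩ := (Ideal.mem_map_iff_of_surjective q hsurj).1 (hp'P hsp)
        have : s - s' ∈ P := hker (by rw [RingHom.mem_ker, map_sub, hss, sub_self])
        simpa using P.add_mem this hs'
    · rw [Nat.cast_add, Nat.cast_one, ← hh, ← height_map_C_of_isPrime]
      exact Ideal.height_add_one_le_of_lt_of_isPrime (lt_of_le_not_ge hQP hle)
    · have := hc.append_map_C (P := P) rfl (h' := 1) (.step g hgP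
        (fun a ha => (hQX.mem_or_mem ha).resolve_left hgQ) hQP hgP hg .refl)
      rwa [Ideal.map_bot] at this

theorem HasRegularChains.mvPolynomial (K : Type*) [Field K] (N : ℕ) :
    HasRegularChains (MvPolynomial (Fin N) K) := by
  induction N with
  | zero => exact .of_ringEquiv (MvPolynomial.isEmptyRingEquiv K (Fin 0)) (.of_field K)
  | succ N ih => exact .of_ringEquiv (MvPolynomial.finSuccEquiv K N).toRingEquiv ih.polynomial

end RegularChain

/-! ### Exactness and depth along a regular sequence, with denominators outside `P`. -/

section LocalExactness

open Matrix

variable {R : Type*} [CommRing R]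

/-- The vectors with all entries in `J`. -/
def vecIdeal (J : Ideal R) (ι : Type*) : Submodule R (ι → R) :=
  Submodule.pi Set.univ fun _ => J

@[simp]
theorem mem_vecIdeal {J : Ideal R} {ι : Type*} {v : ι → R} : v ∈ vecIdeal J ι ↔ ∀ i, v i ∈ J := by
  simp [vecIdeal, Submodule.mem_pi]

theorem vecIdeal_mono {J J' : Ideal R} (h : J ≤ J') (ι : Type*) :
    vecIdeal J ι ≤ vecIdeal J' ι := fun v hv => by
  rw [mem_vecIdeal] at hv ⊢
  exact fun i => h (hv i)

theorem mulVec_mem_vecIdeal {J : Ideal R} {m n : Type*} [Fintype n] (B : Matrix m n R)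
    {v : n → R} (hv : v ∈ vecIdeal J n) : B *ᵥ v ∈ vecIdeal J m := by
  rw [mem_vecIdeal] at hv ⊢
  exact fun i => J.sum_mem fun j _ => J.mul_mem_left _ (hv j)

theorem smul_mem_vecIdeal_of_mem {J : Ideal R} {ι : Type*} {x : R} (hx : x ∈ J) (v : ι → R) :
    x • v ∈ vecIdeal J ι := by
  rw [mem_vecIdeal]
  exact fun i => J.mul_mem_right _ hx

theorem mem_vecIdeal_of_smul_mem {J : Ideal R} {x : R} (hreg : ∀ a, x * a ∈ J → a ∈ J)
    {ι : Type*} {v : ι → R} (hv : x • v ∈ vecIdeal J ι) : v ∈ vecIdeal J ι := by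
  rw [mem_vecIdeal] at hv ⊢
  exact fun i => hreg _ (hv i)

theorem exists_smul_sub_smul_mem_vecIdeal {P J J' : Ideal R} [P.IsPrime] {x : R}
    (hloc : ∀ a ∈ J', ∃ s ∉ P, ∃ b, s * a - x * b ∈ J) {ι : Type*} [Fintype ι] {v : ι → R}
    (hv : v ∈ vecIdeal J' ι) : ∃ s ∉ P, ∃ w : ι → R, s • v - x • w ∈ vecIdeal J ι := by
  rw [mem_vecIdeal] at hv
  obtain ⟨s, hs, w, hw⟩ := exists_common_denominator hloc Finset.univ v fun i _ => hv i
  exact ⟨s, hs, w, mem_vecIdeal.2 fun i => hw i (Finset.mem_univ i)⟩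

/-- Exactness at the middle term of `R ^ l → R ^ n → R ^ m`, modulo `J` and locally at `P`. -/
def LocallyExact (P J : Ideal R) {m n l : Type*} [Fintype n] [Fintype l] (B : Matrix m n R)
    (C : Matrix n l R) : Prop :=
  ∀ v, B *ᵥ v ∈ vecIdeal J m → ∃ s ∉ P, ∃ w, s • v - C *ᵥ w ∈ vecIdeal J n

/-- `D` has, locally at `P`, a generalized inverse. -/
def LocallySplit (P : Ideal R) {m n : Type*} [Fintype m] [Fintype n] (D : Matrix m n R) : Prop :=
  ∃ f ∉ P, ∃ E : Matrix n m R, D * E * D = f • D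

variable {P : Ideal R} [hP : P.IsPrime] {f : ℕ → ℕ}
  {D : ∀ k, Matrix (Fin (f k)) (Fin (f (k + 1))) R}

/-- The long exact sequence of multiplication by `x`, by hand. Up to denominators, `B v = x w₀`
modulo `J`; regularity gives `A w₀ = 0`, so `w₀ = B w₁`, and then `v - x w₁` lies in the kernel of
`B`, hence in the image of `C`. -/
theorem LocallyExact.mod_regular {J J' : Ideal R} {x : R}
    (hreg : ∀ a, x * a ∈ J → a ∈ J) (hJ : J ≤ J') (hxJ : x ∈ J')
    (hloc : ∀ a ∈ J', ∃ s ∉ P, ∃ b, s * a - x * b ∈ J) {p m n l : Type*} [Fintype m] [Fintype n]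
    [Fintype l] {A : Matrix p m R} {B : Matrix m n R} {C : Matrix n l R} (hAB : A * B = 0)
    (h₁ : LocallyExact P J A B) (h₂ : LocallyExact P J B C) : LocallyExact P J' B C := by
  intro v hv
  obtain ⟨s₀, hs₀, w₀, h0⟩ := exists_smul_sub_smul_mem_vecIdeal hloc hv
  obtain ⟨s₁, hs₁, w₁, h1⟩ := h₁ w₀ <| mem_vecIdeal_of_smul_mem hreg <| by
    have := neg_mem (mulVec_mem_vecIdeal A h0)
    rwa [mulVec_sub, mulVec_smul, mulVec_smul, mulVec_mulVec, hAB, zero_mulVec, smul_zero,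
      zero_sub, neg_neg] at this
  obtain ⟨s₂, hs₂, w₂, h2⟩ := h₂ ((s₁ * s₀) • v - x • w₁) <| by
    have := add_mem (Submodule.smul_mem _ s₁ h0) (Submodule.smul_mem _ x h1)
    convert this using 1
    rw [mulVec_sub, mulVec_smul, mulVec_smul]
    module
  refine ⟨s₂ * (s₁ * s₀), hP.mul_notMem hs₂ (hP.mul_notMem hs₁ hs₀), w₂, ?_⟩
  have := add_mem (vecIdeal_mono hJ _ h2) (smul_mem_vecIdeal_of_mem hxJ (s₂ • w₁))
  convert this using 1
  module

theorem RegularChain.locallyExact {h : ℕ} {J : Ideal R} (hc : RegularChain P h J)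
    (hD : ∀ k, D k * D (k + 1) = 0) {k : ℕ}
    (hex : ∀ j, k ≤ j → LocallyExact P J (D j) (D (j + 1))) :
    ∀ j, k + h ≤ j → LocallyExact P P (D j) (D (j + 1)) := by
  induction hc generalizing k with
  | refl => simpa using hex
  | @step h J J' x hx hreg hJ hxJ hloc hc ih =>
    intro j hj
    refine ih (k := k + 1) (fun i hi => ?_) j (by omega)
    obtain ⟨i, rfl⟩ : ∃ i', i = i' + 1 := ⟨i - 1, by omega⟩
    exact (hex i (by omega)).mod_regular hreg hJ hxJ hloc (hD i) (hex (i + 1) (by omega))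

/-- If the cokernel of `D k` modulo `J` has, locally at `P`, a free resolution of length less
than `h`, where `P` is locally generated modulo `J` by a regular sequence of length `h`, then no
nonzero element of the localized cokernel is annihilated by `P`. -/
theorem RegularChain.exists_smul_mem_range {h : ℕ} {J : Ideal R} (hc : RegularChain P h J)
    (hh : h ≠ 0) (hD : ∀ k, D k * D (k + 1) = 0) {k : ℕ}
    (hex : ∀ j, k ≤ j → LocallyExact P J (D j) (D (j + 1)))
    (hsplit : ∀ j, k + h ≤ j + 1 → LocallySplit P (D j)) (u : Fin (f k) → R)
    (hu : ∀ y ∈ P, ∃ s ∉ P, ∃ w, (s * y) • u - D k *ᵥ w ∈ vecIdeal J _) :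
    ∃ s ∉ P, ∃ w, s • u - D k *ᵥ w ∈ vecIdeal J _ := by
  induction hc generalizing k with
  | refl => exact (hh rfl).elim
  | @step h J J' x hx hreg hJ hxJ hloc hc ih =>
    obtain ⟨s₀, hs₀, v, h0⟩ := hu x hx
    rcases Nat.eq_zero_or_pos h with rfl | hpos
    -- Last element of the sequence: `x u` is in the image of `D k`, and the generalized inverse
    -- allows `x` to be cancelled.
    · obtain ⟨g, hg, E, hE⟩ := hsplit k (by omega)
      refine ⟨g * s₀, hP.mul_notMem hg hs₀, E *ᵥ (s₀ • u), ?_⟩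
      refine mem_vecIdeal_of_smul_mem hreg ?_
      have h1 := Submodule.smul_mem _ g h0
      have h2 := mulVec_mem_vecIdeal (D k) (mulVec_mem_vecIdeal E h0)
      rw [mulVec_sub, mulVec_sub, mulVec_mulVec, mulVec_mulVec, mulVec_mulVec, hE,
        smul_mulVec] at h2
      convert sub_mem h1 h2 using 1
      simp only [mulVec_smul, mulVec_mulVec]
      module
    -- Pass to the syzygies: if `x u = D k v`, the class of `v` in the cokernel of `D (k + 1)`
    -- modulo `J'` is again killed by `P`. By induction `v = D (k + 1) w₁ + x t`, so `x u = x D k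
    -- t`, and `x` cancels.
    · obtain ⟨s₁, hs₁, w₁, h1⟩ := ih hpos.ne' (k := k + 1) (fun j hj => by
        obtain ⟨j, rfl⟩ : ∃ i', j = i' + 1 := ⟨j - 1, by omega⟩
        exact (hex j (by omega)).mod_regular hreg hJ hxJ hloc (hD j) (hex (j + 1) (by omega)))
        (fun j hj => hsplit j (by omega)) v (fun y hy => by
          obtain ⟨s₁, hs₁, w, h1⟩ := hu y hy
          obtain ⟨s, hs, z, h2⟩ := hex k le_rfl ((s₁ * y) • v - (s₀ * x) • w) <| by
            have := sub_mem (Submodule.smul_mem _ (s₀ * x) h1) (Submodule.smul_mem _ (s₁ * y) h0)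
            convert this using 1
            rw [mulVec_sub, mulVec_smul, mulVec_smul]
            module
          refine ⟨s * s₁, hP.mul_notMem hs hs₁, z, ?_⟩
          have := add_mem (vecIdeal_mono hJ _ h2)
            (smul_mem_vecIdeal_of_mem hxJ ((s * s₀) • w))
          convert this using 1
          module)
      obtain ⟨s₂, hs₂, t, h2⟩ := exists_smul_sub_smul_mem_vecIdeal hloc h1
      refine ⟨s₂ * s₁ * s₀, hP.mul_notMem (hP.mul_notMem hs₂ hs₁) hs₀, t, ?_⟩
      refine mem_vecIdeal_of_smul_mem hreg ?_
      have h3 := mulVec_mem_vecIdeal (D k) h2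
      rw [mulVec_sub, mulVec_smul, mulVec_smul, mulVec_sub, mulVec_mulVec, hD, zero_mulVec,
        sub_zero, mulVec_smul] at h3
      convert add_mem h3 (Submodule.smul_mem _ (s₂ * s₁) h0) using 1
      module

end LocalExactness

/-! ### Minors, generalized inverses and ranks over residue fields. -/

section Minors

set_option linter.unusedSectionVars false

open Matrix

variable {K : Type*} [Field K] {m n l : Type*} [Fintype m] [Fintype n] [Fintype l]

theorem exists_linearIndependent_rows {r : ℕ} (M : Matrix m n K) (hr : M.rank = r) :
    ∃ I : Fin r → m, LinearIndependent K (M.submatrix I id).row := by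
  rw [M.rank_eq_finrank_span_row] at hr
  subst hr
  obtain ⟨v, hv, -, hi⟩ := Submodule.exists_fun_fin_finrank_span_eq K (Set.range M.row)
  choose I hI using hv
  refine ⟨I, ?_⟩
  rwa [show (M.submatrix I id).row = v from funext hI]

theorem exists_submatrix_det_ne_zero {r : ℕ} (M : Matrix m n K) (hr : M.rank = r) :
    ∃ (I : Fin r → m) (J : Fin r → n), (M.submatrix I J).det ≠ 0 := by
  obtain ⟨I, hI⟩ := exists_linearIndependent_rows M hr
  obtain ⟨J, hJ⟩ := exists_linearIndependent_rows (r := r) (M.submatrix I id)ᵀ (by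
    rw [rank_transpose, hI.rank_matrix, Fintype.card_fin])
  refine ⟨I, J, ?_⟩
  rw [← det_transpose]
  exact ((isUnit_iff_isUnit_det _).1 (linearIndependent_rows_iff_isUnit.1 hJ)).ne_zero

theorem le_rank_of_submatrix_det_ne_zero {r : ℕ} (M : Matrix m n K) {I : Fin r → m} {J : Fin r → n}
    (h : (M.submatrix I J).det ≠ 0) : r ≤ M.rank := by
  have := rank_of_det_ne_zero h
  rw [Fintype.card_fin] at this
  rw [← this]
  exact rank_submatrix_le _ _ _

variable [DecidableEq m] [DecidableEq n]

/-- A generalized inverse of `M` up to the factor `(M.submatrix I J).det`. -/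
def minorInverse {R : Type*} [CommRing R] {r : ℕ} (M : Matrix m n R) (I : Fin r → m)
    (J : Fin r → n) : Matrix n m R :=
  (1 : Matrix n n R).submatrix id J * (M.submatrix I J).adjugate *
    (1 : Matrix m m R).submatrix I id

theorem mul_one_submatrix_id {R : Type*} [CommRing R] {o : Type*} (M : Matrix m n R) (J : o → n) :
    M * (1 : Matrix n n R).submatrix id J = M.submatrix id J := by
  ext i j
  simp [mul_apply, one_apply]

theorem one_submatrix_id_mul {R : Type*} [CommRing R] {o : Type*} (M : Matrix m n R) (I : o → m) :
    (1 : Matrix m m R).submatrix I id * M = M.submatrix I id := by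
  ext i j
  simp [mul_apply, one_apply]

/-- The columns `J` span the column space, so `M` factors through them; restricting this
factorization to the rows `I` reduces the identity to adjugate times matrix equals determinant. -/
theorem mul_minorInverse_mul {r : ℕ} (M : Matrix m n K) (hr : M.rank = r) {I : Fin r → m}
    {J : Fin r → n} (h : (M.submatrix I J).det ≠ 0) :
    M * minorInverse M I J * M = (M.submatrix I J).det • M := by
  have hle : LinearMap.range (M.submatrix id J).mulVecLin ≤ LinearMap.range M.mulVecLin := by
    rw [← mul_one_submatrix_id, mulVecLin_mul]
    exact LinearMap.range_comp_le_range _ _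
  have heq := Submodule.eq_of_le_of_finrank_le hle (by
    change M.rank ≤ (M.submatrix id J).rank
    rw [hr]
    exact le_rank_of_submatrix_det_ne_zero (I := I) (J := id) (M.submatrix id J)
      (by simpa using h))
  have hX : ∀ j, ∃ x, M.submatrix id J *ᵥ x = M.col j := fun j => by
    have : M.col j ∈ LinearMap.range M.mulVecLin := ⟨Pi.single j 1, by simp⟩
    rw [← heq] at this
    exact this
  choose X hX using hX
  have hM : M = M.submatrix id J * (of X)ᵀ := by
    ext i j
    exact (congrFun (hX j) i).symm
  have hI : M.submatrix I id = M.submatrix I J * (of X)ᵀ := by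
    conv_lhs => rw [hM]
    rfl
  calc M * minorInverse M I J * M
      = (M * (1 : Matrix n n K).submatrix id J) * (M.submatrix I J).adjugate *
        ((1 : Matrix m m K).submatrix I id * M) := by
        simp only [minorInverse, Matrix.mul_assoc]
    _ = M.submatrix id J * ((M.submatrix I J).adjugate * M.submatrix I J) * (of X)ᵀ := by
        rw [mul_one_submatrix_id, one_submatrix_id_mul, hI]
        simp only [Matrix.mul_assoc]
    _ = (M.submatrix I J).det • M := by
        rw [adjugate_mul, Matrix.mul_smul, Matrix.mul_one, smul_mul, ← hM]

variable {R : Type*} [CommRing R]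

/-- The rank of a matrix over the residue field of a prime. -/
noncomputable def residueRank (P : Ideal R) [P.IsPrime] (M : Matrix m n R) : ℕ :=
  (M.map (algebraMap R P.ResidueField)).rank

theorem map_submatrix_det {S : Type*} [CommRing S] (φ : R →+* S) {r : ℕ} (M : Matrix m n R)
    (I : Fin r → m) (J : Fin r → n) :
    ((M.map φ).submatrix I J).det = φ (M.submatrix I J).det := by
  rw [RingHom.map_det]
  rfl

theorem algebraMap_residueField_ne_zero_iff {P : Ideal R} [P.IsPrime] {a : R} :
    algebraMap R P.ResidueField a ≠ 0 ↔ a ∉ P := by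
  rw [Ne, ← RingHom.mem_ker, P.ker_algebraMap_residueField]

theorem exists_minor_notMem {P : Ideal R} [P.IsPrime] {M : Matrix m n R} {r : ℕ}
    (h : residueRank P M = r) :
    ∃ (I : Fin r → m) (J : Fin r → n), (M.submatrix I J).det ∉ P := by
  obtain ⟨I, J, hIJ⟩ := exists_submatrix_det_ne_zero _ h
  rw [map_submatrix_det, algebraMap_residueField_ne_zero_iff] at hIJ
  exact ⟨I, J, hIJ⟩

theorem le_residueRank_of_minor_notMem {P : Ideal R} [P.IsPrime] {M : Matrix m n R} {r : ℕ}
    {I : Fin r → m} {J : Fin r → n} (h : (M.submatrix I J).det ∉ P) : r ≤ residueRank P M := by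
  refine le_rank_of_submatrix_det_ne_zero (I := I) (J := J) _ ?_
  rwa [map_submatrix_det, algebraMap_residueField_ne_zero_iff]

theorem residueRank_anti {P P' : Ideal R} [P.IsPrime] [P'.IsPrime] (h : P ≤ P')
    (M : Matrix m n R) : residueRank P' M ≤ residueRank P M := by
  obtain ⟨I, J, hIJ⟩ := exists_minor_notMem (P := P') (M := M) rfl
  exact le_residueRank_of_minor_notMem fun hmem => hIJ (h hmem)

theorem minorInverse_map {S : Type*} [CommRing S] (φ : R →+* S) {r : ℕ} (M : Matrix m n R)
    (I : Fin r → m) (J : Fin r → n) :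
    (minorInverse M I J).map φ = minorInverse (M.map φ) I J := by
  have h : (M.submatrix I J).adjugate.map φ = ((M.map φ).submatrix I J).adjugate :=
    φ.map_adjugate (M.submatrix I J)
  rw [minorInverse, minorInverse, Matrix.map_mul, Matrix.map_mul, ← submatrix_map, ← submatrix_map,
    Matrix.map_one φ (map_zero φ) (map_one φ), Matrix.map_one φ (map_zero φ) (map_one φ), h]

theorem algebraMap_residueField_bot_injective [IsDomain R] :
    Function.Injective (algebraMap R (⊥ : Ideal R).ResidueField) := by
  rw [RingHom.injective_iff_ker_eq_bot, Ideal.ker_algebraMap_residueField]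

/-- Constancy of rank provides a minor of generic size outside `P`; the generalized inverse identity
holds over the fraction field and descends by injectivity. -/
theorem locallySplit_of_residueRank_eq [IsDomain R] {P : Ideal R} [P.IsPrime] {M : Matrix m n R}
    (h : residueRank P M = residueRank ⊥ M) : LocallySplit P M := by
  obtain ⟨r, hr⟩ : ∃ r, residueRank ⊥ M = r := ⟨_, rfl⟩
  obtain ⟨I, J, hIJ⟩ := exists_minor_notMem (h.trans hr)
  refine ⟨_, hIJ, minorInverse M I J, ?_⟩
  apply Matrix.map_injective algebraMap_residueField_bot_injective
  have hdet : ((M.map (algebraMap R (⊥ : Ideal R).ResidueField)).submatrix I J).det ≠ 0 := by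
    rw [map_submatrix_det, algebraMap_residueField_ne_zero_iff]
    exact fun h => hIJ (bot_le (a := P) h)
  change Matrix.map _ _ = Matrix.map _ _
  rw [Matrix.map_mul, Matrix.map_mul, minorInverse_map, mul_minorInverse_mul _ hr hdet,
    map_submatrix_det]
  ext i j
  simp

theorem exists_smul_eq_algebraMap_comp {P : Ideal R} [P.IsPrime] (z : n → P.ResidueField) :
    ∃ s ∉ P, ∃ v : n → R,
      algebraMap R P.ResidueField s • z = algebraMap R P.ResidueField ∘ v := by
  obtain ⟨b, hb⟩ :=
    IsLocalization.exist_integer_multiples_of_finite (nonZeroDivisors (R ⧸ P)) z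
  obtain ⟨s, hs⟩ := Ideal.Quotient.mk_surjective (b : R ⧸ P)
  choose a ha using hb
  choose v hv using fun i => Ideal.Quotient.mk_surjective (a i)
  refine ⟨s, fun h => nonZeroDivisors.ne_zero b.2 ?_, v, ?_⟩
  · rw [← hs, Ideal.Quotient.eq_zero_iff_mem]
    exact h
  · funext i
    have := ha i
    rw [Algebra.smul_def, ← hv i, ← hs] at this
    simpa [Algebra.smul_def] using this.symm

theorem map_mulVec_comp {S : Type*} [CommRing S] (φ : R →+* S) (M : Matrix m n R) (v : n → R) :
    M.map φ *ᵥ (φ ∘ v) = φ ∘ (M *ᵥ v) :=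
  (funext fun i => RingHom.map_mulVec φ M v i).symm

theorem algebraMap_comp_eq_zero_iff {P : Ideal R} [P.IsPrime] {v : n → R} :
    algebraMap R P.ResidueField ∘ v = 0 ↔ v ∈ vecIdeal P n := by
  rw [mem_vecIdeal, funext_iff]
  refine forall_congr' fun i => ?_
  rw [← not_iff_not]
  exact algebraMap_residueField_ne_zero_iff

theorem finrank_ker_mulVecLin (B : Matrix m n K) :
    B.rank + Module.finrank K (LinearMap.ker B.mulVecLin) = Fintype.card n := by
  rw [Matrix.rank, LinearMap.finrank_range_add_finrank_ker, Module.finrank_fintype_fun_eq_card]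

theorem LocallyExact.residueRank_add {P : Ideal R} [hP : P.IsPrime] {B : Matrix m n R}
    {C : Matrix n l R} [DecidableEq l] (hBC : B * C = 0) (h : LocallyExact P P B C) :
    residueRank P B + residueRank P C = Fintype.card n := by
  set φ := algebraMap R P.ResidueField
  refine le_antisymm (rank_add_rank_le_card_of_mul_eq_zero ?_) ?_
  · rw [← Matrix.map_mul, hBC, Matrix.map_zero _ (map_zero _)]
  · rw [← finrank_ker_mulVecLin (B.map φ)]
    refine Nat.add_le_add_left (Submodule.finrank_mono fun z hz => ?_) _
    rw [LinearMap.mem_ker, mulVecLin_apply] at hz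
    obtain ⟨s, hs, v, hv⟩ := exists_smul_eq_algebraMap_comp z
    obtain ⟨s', hs', w, hw⟩ := h v <| by
      rw [← algebraMap_comp_eq_zero_iff, ← map_mulVec_comp, ← hv, mulVec_smul, hz, smul_zero]
    rw [← algebraMap_comp_eq_zero_iff] at hw
    have h1 : (φ s' * φ s) • z = C.map φ *ᵥ (φ ∘ w) := by
      rw [map_mulVec_comp, ← sub_eq_zero, mul_smul, hv, ← hw]
      funext i
      simp [φ, Algebra.smul_def]
    have h2 : φ s' * φ s ≠ 0 := mul_ne_zero (algebraMap_residueField_ne_zero_iff.2 hs')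
      (algebraMap_residueField_ne_zero_iff.2 hs)
    rw [← Submodule.smul_mem_iff _ h2, h1]
    exact ⟨_, rfl⟩

/-- A dimension count gives exactness over the fraction field; then denominators are cleared. -/
theorem exists_smul_eq_mulVec_of_residueRank_add [IsDomain R] {B : Matrix m n R}
    {C : Matrix n l R} [DecidableEq l] (hBC : B * C = 0)
    (h : residueRank ⊥ B + residueRank ⊥ C = Fintype.card n) {v : n → R} (hv : B *ᵥ v = 0) :
    ∃ s : R, s ≠ 0 ∧ ∃ w, s • v = C *ᵥ w := by
  set φ := algebraMap R (⊥ : Ideal R).ResidueField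
  have hle : LinearMap.range (C.map φ).mulVecLin ≤ LinearMap.ker (B.map φ).mulVecLin := by
    rw [LinearMap.range_le_ker_iff, ← mulVecLin_mul, ← Matrix.map_mul, hBC,
      Matrix.map_zero _ (map_zero _), mulVecLin_zero]
  have heq := Submodule.eq_of_le_of_finrank_le hle (by
    have := finrank_ker_mulVecLin (B.map φ)
    change _ ≤ residueRank ⊥ C
    change residueRank ⊥ B + _ = _ at this
    omega)
  have hmem : φ ∘ v ∈ LinearMap.range (C.map φ).mulVecLin := by
    rw [heq, LinearMap.mem_ker, mulVecLin_apply, map_mulVec_comp, hv]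
    funext i
    simp
  obtain ⟨z, hz⟩ := hmem
  obtain ⟨s, hs, w, hw⟩ := exists_smul_eq_algebraMap_comp z
  refine ⟨s, fun h => hs (by simp [h]), w, ?_⟩
  apply algebraMap_residueField_bot_injective.comp_left
  change φ ∘ (s • v) = φ ∘ _
  rw [← map_mulVec_comp, ← hw, mulVec_smul]
  change _ = φ s • (C.map φ).mulVecLin z
  rw [hz]
  funext i
  simp

end Minors

/-! ### The exactness criterion for matrices over a domain. -/

section Criterion

set_option linter.unusedSectionVars false

open Matrix

variable {R : Type*} [CommRing R] [IsDomain R] {f : ℕ → ℕ}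
  {D : ∀ k, Matrix (Fin (f k)) (Fin (f (k + 1))) R}

/-- Exactness of a complex of free modules in all positive degrees. -/
def MatrixExact (D : ∀ k, Matrix (Fin (f k)) (Fin (f (k + 1))) R) : Prop :=
  ∀ k v, D k *ᵥ v = 0 → ∃ w, v = D (k + 1) *ᵥ w

theorem mem_vecIdeal_bot {ι : Type*} {v : ι → R} : v ∈ vecIdeal (⊥ : Ideal R) ι ↔ v = 0 := by
  simp [funext_iff]

theorem locallyExact_bot_of_exact {P : Ideal R} [hP : P.IsPrime] {m n l : Type*} [Fintype n]
    [Fintype l] {B : Matrix m n R} {C : Matrix n l R}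
    (h : ∀ v, B *ᵥ v = 0 → ∃ w, v = C *ᵥ w) : LocallyExact P ⊥ B C := by
  intro v hv
  obtain ⟨w, hw⟩ := h v (mem_vecIdeal_bot.1 hv)
  exact ⟨1, (Ideal.ne_top_iff_one P).1 hP.ne_top, w, mem_vecIdeal_bot.2 (by simp [← hw])⟩

theorem MatrixExact.residueRank_add (hD : ∀ k, D k * D (k + 1) = 0) (hex : MatrixExact D) (k : ℕ) :
    residueRank ⊥ (D k) + residueRank ⊥ (D (k + 1)) = f (k + 1) := by
  simpa using (locallyExact_bot_of_exact (P := ⊥) (hex k)).residueRank_add (hD k)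

theorem MatrixExact.residueRank_eq (hD : ∀ k, D k * D (k + 1) = 0) (hex : MatrixExact D) {n : ℕ}
    (hf : ∀ k, n < k → f k = 0) {P : Ideal R} [P.IsPrime] {h : ℕ} (hc : RegularChain P h ⊥) {k : ℕ}
    (hk : h ≤ k) : residueRank P (D k) = residueRank ⊥ (D k) := by
  have hrank : ∀ j, h ≤ j → residueRank P (D j) + residueRank P (D (j + 1)) = f (j + 1) :=
    fun j hj => by
      simpa using (hc.locallyExact hD (k := 0)
        (fun j _ => locallyExact_bot_of_exact (hex j)) j (by omega)).residueRank_add (hD j)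
  -- Descending induction on `j`: the rank sums at `P` and at the zero ideal agree, and both
  -- complexes vanish beyond `n`.
  suffices H : ∀ d j, h ≤ j → n ≤ j + d → residueRank P (D j) = residueRank ⊥ (D j) from
    H n k hk (by omega)
  intro d
  induction d with
  | zero =>
    intro j hj hn
    have h1 := hrank j hj
    have h2 := hex.residueRank_add hD j
    have h3 := hf (j + 1) (by omega)
    omega
  | succ d ih =>
    intro j hj hn
    have h1 := hrank j hj
    have h2 := hex.residueRank_add hD j
    have h3 := ih (j + 1) (by omega) (by omega)
    omega

theorem MatrixExact.of_residueRank [IsNoetherianRing R] (H : HasRegularChains R)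
    (hD : ∀ k, D k * D (k + 1) = 0) {n : ℕ} (hf : ∀ k, n < k → f k = 0)
    (hrank : ∀ k, k < n → residueRank ⊥ (D k) + residueRank ⊥ (D (k + 1)) = f (k + 1))
    (hheight : ∀ k, k < n → ∀ P : Ideal R, ∀ _ : P.IsPrime, P.height ≤ k →
      residueRank P (D k) = residueRank ⊥ (D k)) : MatrixExact D := by
  suffices H : ∀ d k, n ≤ k + d → ∀ v, D k *ᵥ v = 0 → ∃ w, v = D (k + 1) *ᵥ w from
    fun k => H n k (by omega)
  intro d
  induction d with
  | zero =>
    intro k hk v _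
    have : IsEmpty (Fin (f (k + 1))) := by rw [hf (k + 1) (by omega)]; infer_instance
    exact ⟨0, Subsingleton.elim _ _⟩
  | succ d ih =>
    intro k hk
    rcases lt_or_ge k n with hkn | hkn
    swap
    · intro v _
      have : IsEmpty (Fin (f (k + 1))) := by rw [hf (k + 1) (by omega)]; infer_instance
      exact ⟨0, Subsingleton.elim _ _⟩
    intro v hv
    set M := LinearMap.range (D (k + 1)).mulVecLin
    by_contra hne
    have hv0 : M.mkQ v ≠ 0 := by
      rw [Ne, Submodule.mkQ_apply, Submodule.Quotient.mk_eq_zero]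
      rintro ⟨w, hw⟩
      exact hne ⟨w, hw.symm⟩
    -- `P` contains the annihilator of the class of `v`, in particular the nonzero `a` found below,
    -- so its height is positive.
    obtain ⟨P, hPass, hle⟩ := exists_le_isAssociatedPrime_of_isNoetherianRing R _ hv0
    have hP := hPass.isPrime
    obtain ⟨-, u', hu'⟩ := isAssociatedPrime_iff.1 hPass
    obtain ⟨u, rfl⟩ := M.mkQ_surjective u'
    have hPmem : ∀ y, y ∈ P ↔ ∃ w, y • u = D (k + 1) *ᵥ w := fun y => by
      rw [hu', Submodule.mem_colon_singleton, Submodule.mem_bot, ← map_smul,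
        Submodule.mkQ_apply, Submodule.Quotient.mk_eq_zero]
      exact exists_congr fun w => eq_comm
    obtain ⟨a, ha0, w, hw⟩ := exists_smul_eq_mulVec_of_residueRank_add (hD k)
      (by simpa using hrank k hkn) hv
    have haP : a ∈ P := hle <| by
      rw [Submodule.mem_colon_singleton, Submodule.mem_bot, ← map_smul,
        Submodule.mkQ_apply, Submodule.Quotient.mk_eq_zero]
      exact ⟨w, hw.symm⟩
    obtain ⟨h, hh, hc⟩ := H P hP
    have hh0 : h ≠ 0 := by
      rintro rfl
      rw [Nat.cast_zero, Ideal.height_eq_zero_iff_eq_bot] at hh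
      exact ha0 (by simpa [hh] using haP)
    obtain ⟨s, hs, z, hz⟩ := hc.exists_smul_mem_range hh0 hD (k := k + 1)
      (fun j hj => locallyExact_bot_of_exact (ih j (by omega))) (fun j hj => by
        rcases lt_or_ge j n with hjn | hjn
        · refine locallySplit_of_residueRank_eq (hheight j hjn P hP ?_)
          rw [hh]
          exact_mod_cast (by omega : h ≤ j)
        · have : IsEmpty (Fin (f (j + 1))) := by rw [hf (j + 1) (by omega)]; infer_instance
          exact ⟨1, (Ideal.ne_top_iff_one P).1 hP.ne_top, 0, by ext i j; exact isEmptyElim j⟩)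
      u (fun y hy => by
        obtain ⟨w, hw⟩ := (hPmem y).1 hy
        exact ⟨1, (Ideal.ne_top_iff_one P).1 hP.ne_top, w, by simp [hw]⟩)
    rw [mem_vecIdeal_bot, sub_eq_zero] at hz
    exact hs ((hPmem s).2 ⟨z, hz⟩)

end Criterion

/-! ### Matrices of semilinear actions. -/

section Semilinear

open Matrix

variable {R M M' : Type*} [CommRing R] [AddCommGroup M] [Module R M] [AddCommGroup M'] [Module R M']
  {ι ι' : Type*} [Fintype ι] [Fintype ι']

/-- The matrix of an additive endomorphism in a given basis. -/
noncomputable def actionMatrix (b : Module.Basis ι R M) (φ : M → M) : Matrix ι ι R :=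
  of fun i j => b.repr (φ (b j)) i

theorem repr_semilinear (b : Module.Basis ι R M) (σ : R →+* R) (φ : AddMonoid.End M)
    (hφ : ∀ (a : R) (x : M), φ (a • x) = σ a • φ x) (x : M) :
    ⇑(b.repr (φ x)) = actionMatrix b φ *ᵥ (σ ∘ b.repr x) := by
  funext i
  conv_lhs => rw [← b.sum_repr x, map_sum]
  simp only [hφ]
  simp [mulVec, dotProduct, actionMatrix, mul_comm]

theorem actionMatrix_mul_map [DecidableEq ι] (b : Module.Basis ι R M) (σ : R →+* R)
    (φ ψ : AddMonoid.End M) (hφ : ∀ (a : R) (x : M), φ (a • x) = σ a • φ x)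
    (h : ∀ x, φ (ψ x) = x) : actionMatrix b φ * (actionMatrix b ψ).map σ = 1 := by
  ext i j
  have := congrFun (repr_semilinear b σ φ hφ (ψ (b j))) i
  rw [h] at this
  rw [one_apply, show (if i = j then (1 : R) else 0) = b.repr (b j) i by
    rw [b.repr_self, Finsupp.single_apply]; simp only [eq_comm], this]
  rfl

theorem toMatrix_mul_actionMatrix [DecidableEq ι] (b : Module.Basis ι R M)
    (b' : Module.Basis ι' R M') (σ : R →+* R) (d : M →ₗ[R] M') (φ : AddMonoid.End M)
    (φ' : AddMonoid.End M') (hφ' : ∀ (a : R) (x : M'), φ' (a • x) = σ a • φ' x)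
    (h : ∀ x, d (φ x) = φ' (d x)) :
    LinearMap.toMatrix b b' d * actionMatrix b φ =
      actionMatrix b' φ' * (LinearMap.toMatrix b b' d).map σ := by
  ext i j
  have h1 := congrFun (LinearMap.toMatrix_mulVec_repr b b' d (φ (b j))) i
  rw [h, repr_semilinear b' σ φ' hφ'] at h1
  refine h1.trans ?_
  simp only [mulVec, dotProduct, mul_apply, map_apply, LinearMap.toMatrix_apply]
  rfl

end Semilinear

/-! ### Ranks at points, orbits and zero loci. -/

section PointRank

set_option linter.unusedSectionVars false

open Matrix MvPolynomial

variable {N : ℕ} {m n : Type*} [Fintype m] [Fintype n]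

/-- The rank of a matrix of polynomials at a point. -/
noncomputable def pointRank (D : Matrix m n (CoordRing N)) (q : Fin N → ℂ) : ℕ :=
  (D.map (eval q)).rank

theorem rankAt_eq_pointRank {M M' : Type*} [AddCommGroup M] [Module (CoordRing N) M]
    [AddCommGroup M'] [Module (CoordRing N) M'] [DecidableEq n]
    (b : Module.Basis n (CoordRing N) M) (b' : Module.Basis m (CoordRing N) M')
    (d : M →ₗ[CoordRing N] M') (q : Fin N → ℂ) :
    rankAt d q = pointRank (LinearMap.toMatrix b b' d) q := by
  let : Algebra (CoordRing N) ℂ := (eval q).toAlgebra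
  have h := LinearMap.toMatrix_baseChange ℂ d b b'
  rw [pointRank, rankAt]
  change _ = ((LinearMap.toMatrix b b' d).map (algebraMap (CoordRing N) ℂ)).rank
  rw [← h, rank_eq_finrank_range_toLin _ (Algebra.TensorProduct.basis ℂ b')
    (Algebra.TensorProduct.basis ℂ b), toLin_toMatrix]

variable [DecidableEq m] [DecidableEq n]

theorem exists_minor_eval_ne_zero (D : Matrix m n (CoordRing N)) (q : Fin N → ℂ) :
    ∃ (I : Fin (pointRank D q) → m) (J : Fin (pointRank D q) → n),
      eval q (D.submatrix I J).det ≠ 0 := by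
  obtain ⟨I, J, h⟩ := exists_submatrix_det_ne_zero (D.map (eval q)) rfl
  exact ⟨I, J, by rwa [map_submatrix_det] at h⟩

theorem le_pointRank {D : Matrix m n (CoordRing N)} {q : Fin N → ℂ} {r : ℕ} {I : Fin r → m}
    {J : Fin r → n} (h : eval q (D.submatrix I J).det ≠ 0) : r ≤ pointRank D q :=
  le_rank_of_submatrix_det_ne_zero (I := I) (J := J) _ (by rwa [map_submatrix_det])

theorem pointRank_le_residueRank {P : Ideal (CoordRing N)} [P.IsPrime]
    (D : Matrix m n (CoordRing N)) {q : Fin N → ℂ} (hq : q ∈ zeroLocus ℂ P) :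
    pointRank D q ≤ residueRank P D := by
  obtain ⟨I, J, h⟩ := exists_minor_eval_ne_zero D q
  exact le_residueRank_of_minor_notMem fun hmem => h (by
    simpa [aeval_eq_eval] using hq _ hmem)

variable {G : Type*} [Group G] {ρ : Representation ℂ G (Fin N → ℂ)}

/-- A matrix of polynomials whose rank is constant along the orbits. -/
def IsOrbitInvariant (ρ : Representation ℂ G (Fin N → ℂ)) (D : Matrix m n (CoordRing N)) : Prop :=
  ∀ g v, pointRank D (ρ g v) = pointRank D v

theorem map_coordAct_map_eval {m n : Type*} (D : Matrix m n (CoordRing N)) (g : G)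
    (v : Fin N → ℂ) :
    (D.map (coordAct ρ g : CoordRing N →+* CoordRing N)).map (eval (ρ g v)) = D.map (eval v) := by
  ext i j
  simp [eval_coordAct, ← Module.End.mul_apply, ← map_mul]

/-- Evaluating the equivariance relation at `ρ g v` relates the matrices of `d` at `ρ g v` and at
`v` through the action matrices; the one on the source is invertible there. This gives one
inequality, and `g⁻¹` gives the other. -/
theorem isOrbitInvariant_toMatrix {M M' : Type*} [AddCommGroup M] [Module (CoordRing N) M]
    [AddCommGroup M'] [Module (CoordRing N) M']
    (b : Module.Basis n (CoordRing N) M) (b' : Module.Basis m (CoordRing N) M')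
    (d : M →ₗ[CoordRing N] M') (act : G →* AddMonoid.End M) (act' : G →* AddMonoid.End M')
    (hact : ∀ g (f : CoordRing N) x, act g (f • x) = coordAct ρ g f • act g x)
    (hact' : ∀ g (f : CoordRing N) x, act' g (f • x) = coordAct ρ g f • act' g x)
    (hd : ∀ g x, d (act g x) = act' g (d x)) :
    IsOrbitInvariant ρ (LinearMap.toMatrix b b' d) := by
  have key : ∀ g v, pointRank (LinearMap.toMatrix b b' d) (ρ g v) ≤
      pointRank (LinearMap.toMatrix b b' d) v := by
    intro g v
    set D := LinearMap.toMatrix b b' d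
    have h1 := congrArg (fun A => A.map (eval (ρ g v))) <|
      toMatrix_mul_actionMatrix b b' (coordAct ρ g : CoordRing N →+* CoordRing N) d (act g)
        (act' g) (hact' g) (hd g)
    have h2 := congrArg (fun A => A.map (eval (ρ g v))) <|
      actionMatrix_mul_map b (coordAct ρ g : CoordRing N →+* CoordRing N) (act g) (act g⁻¹)
        (hact g) (fun x => by
          change (act g * act g⁻¹) x = x
          rw [← map_mul, mul_inv_cancel, map_one]
          rfl)
    simp only [Matrix.map_mul, map_coordAct_map_eval] at h1 h2
    rw [Matrix.map_one _ (map_zero _) (map_one _)] at h2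
    rw [pointRank, ← Matrix.mul_one (Matrix.map _ _), ← h2, ← Matrix.mul_assoc, h1]
    exact (rank_mul_le_left _ _).trans (rank_mul_le_right _ _)
  refine fun g v => le_antisymm (key g v) ?_
  have := key g⁻¹ (ρ g v)
  rwa [← Module.End.mul_apply, ← map_mul, inv_mul_cancel, map_one, Module.End.one_apply] at this

theorem IsOrbitInvariant.pointRank_eq {D : Matrix m n (CoordRing N)} (hD : IsOrbitInvariant ρ D)
    {v q : Fin N → ℂ} (hq : q ∈ orbitOf ρ v) : pointRank D q = pointRank D v := by
  obtain ⟨g, rfl⟩ := hq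
  exact hD g v

theorem vanishingIdeal_zariskiClosure (S : Set (Fin N → ℂ)) :
    vanishingIdeal ℂ (zariskiClosure S) = vanishingIdeal ℂ S :=
  (zeroLocus_vanishingIdeal_galoisConnection (k := ℂ) (K := ℂ) (σ := Fin N)).u_l_u_eq_u S

theorem IsOrbitInvariant.pointRank_of_dense {D : Matrix m n (CoordRing N)}
    (hD : IsOrbitInvariant ρ D) {p : Fin N → ℂ}
    (hp : zariskiClosure (orbitOf ρ p) = Set.univ) : pointRank D p = residueRank ⊥ D := by
  refine le_antisymm (pointRank_le_residueRank D (by simp)) ?_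
  obtain ⟨I, J, h⟩ := exists_minor_notMem (P := ⊥) (M := D) rfl
  have hmem : (D.submatrix I J).det ∉ vanishingIdeal ℂ (orbitOf ρ p) := fun hmem => by
    rw [← vanishingIdeal_zariskiClosure, hp] at hmem
    refine h ((Submodule.mem_bot _).2 (MvPolynomial.funext fun q => ?_))
    simpa [aeval_eq_eval] using hmem q (Set.mem_univ q)
  rw [mem_vanishingIdeal_iff] at hmem
  push Not at hmem
  obtain ⟨q, hq, hne⟩ := hmem
  rw [← hD.pointRank_eq hq]
  exact le_pointRank (by simpa [aeval_eq_eval] using hne)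

theorem IsOrbitInvariant.exists_le_pointRank {t : ℕ} {pt : Fin (t + 1) → (Fin N → ℂ)}
    {D : Matrix m n (CoordRing N)} (hD : IsOrbitInvariant ρ D)
    (hpt : ∀ v : Fin N → ℂ, ∃ j, v ∈ orbitOf ρ (pt j)) {r : ℕ} {P : Ideal (CoordRing N)}
    [hP : P.IsPrime]
    (hcodim : ∀ j, pointRank D (pt j) < r → P.height < codim (zariskiClosure (orbitOf ρ (pt j)))) :
    ∃ q ∈ zeroLocus ℂ P, r ≤ pointRank D q := by
  have hex : ∀ j, ∃ f ∉ P, pointRank D (pt j) < r →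
      f ∈ vanishingIdeal ℂ (orbitOf ρ (pt j)) := fun j => by
    by_cases hj : pointRank D (pt j) < r
    · have hnle : ¬ vanishingIdeal ℂ (orbitOf ρ (pt j)) ≤ P := fun hle =>
        (hcodim j hj).not_ge (by
          rw [codim, vanishingIdeal_zariskiClosure]
          exact Ideal.height_mono hle)
      obtain ⟨f, hf, hfP⟩ := SetLike.not_le_iff_exists.1 hnle
      exact ⟨f, hfP, fun _ => hf⟩
    · exact ⟨1, (Ideal.ne_top_iff_one P).1 hP.ne_top, fun h => (hj h).elim⟩
  choose f hfP hf using hex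
  -- By the Nullstellensatz the product, being outside the prime `P`, is nonzero somewhere on its
  -- zero locus; such a point avoids every orbit of rank less than `r`.
  have hprod : ∏ j, f j ∉ vanishingIdeal ℂ (zeroLocus ℂ P) := by
    rw [IsPrime.vanishingIdeal_zeroLocus]
    intro hmem
    obtain ⟨j, -, hj⟩ := Ideal.IsPrime.prod_mem_iff.1 hmem
    exact hfP j hj
  rw [mem_vanishingIdeal_iff] at hprod
  push Not at hprod
  obtain ⟨q, hq, hne⟩ := hprod
  refine ⟨q, hq, ?_⟩
  obtain ⟨j, hj⟩ := hpt q
  rw [hD.pointRank_eq hj]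
  by_contra! hlt
  rw [map_prod] at hne
  exact Finset.prod_ne_zero_iff.1 hne j (Finset.mem_univ j) (hf j hlt q hj)

end PointRank

/-! ### From chain complexes to matrices. -/

section ChainComplexMatrices

open Matrix

variable {R : Type*} [CommRing R] (X : ChainComplex (ModuleCat.{u} R) ℕ) {r : ℕ → ℕ}
  (b : ∀ k, Module.Basis (Fin (r k)) R (X.X k))

/-- The matrix of the differential `X_{k+1} → X_k`. -/
noncomputable def differentialMatrix (k : ℕ) : Matrix (Fin (r k)) (Fin (r (k + 1))) R :=
  LinearMap.toMatrix (b (k + 1)) (b k) (X.d (k + 1) k).hom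

theorem differentialMatrix_mul (k : ℕ) :
    differentialMatrix X b k * differentialMatrix X b (k + 1) = 0 := by
  rw [differentialMatrix, differentialMatrix, ← LinearMap.toMatrix_comp, ← ModuleCat.hom_comp,
    X.d_comp_d, ModuleCat.hom_zero, map_zero]

theorem exactAt_iff_matrixExact :
    (∀ k, 1 ≤ k → X.ExactAt k) ↔ MatrixExact (differentialMatrix X b) := by
  have key : ∀ k, X.ExactAt (k + 1) ↔ ∀ v, differentialMatrix X b k *ᵥ v = 0 →
      ∃ w, v = differentialMatrix X b (k + 1) *ᵥ w := by
    intro k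
    rw [X.exactAt_iff' (k + 2) (k + 1) k (by simp) (by simp), ShortComplex.moduleCat_exact_iff]
    change (∀ x : X.X (k + 1), (X.d (k + 1) k).hom x = 0 →
      ∃ y : X.X (k + 2), (X.d (k + 2) (k + 1)).hom y = x) ↔ _
    constructor
    · intro h v hv
      obtain ⟨y, hy⟩ := h ((b (k + 1)).equivFun.symm v) <| by
        apply (b k).equivFun.injective
        rw [map_zero, ← hv]
        conv_rhs => rw [← (b (k + 1)).equivFun.apply_symm_apply v]
        exact (LinearMap.toMatrix_mulVec_repr (b (k + 1)) (b k) _ _).symm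
      refine ⟨(b (k + 2)).equivFun y, ?_⟩
      rw [← (b (k + 1)).equivFun.apply_symm_apply v, ← hy]
      exact (LinearMap.toMatrix_mulVec_repr (b (k + 2)) (b (k + 1)) _ _).symm
    · intro h x hx
      obtain ⟨w, hw⟩ := h ((b (k + 1)).equivFun x) <| by
        refine (LinearMap.toMatrix_mulVec_repr (b (k + 1)) (b k) _ _).trans ?_
        rw [hx, map_zero]
        rfl
      refine ⟨(b (k + 2)).equivFun.symm w, (b (k + 1)).equivFun.injective ?_⟩
      rw [hw]
      conv_rhs => rw [← (b (k + 2)).equivFun.apply_symm_apply w]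
      exact (LinearMap.toMatrix_mulVec_repr (b (k + 2)) (b (k + 1)) _ _).symm
  constructor
  · exact fun h k => (key k).1 (h (k + 1) (by omega))
  · intro h k hk
    obtain ⟨k, rfl⟩ : ∃ k', k = k' + 1 := ⟨k - 1, by omega⟩
    exact (key k).2 (h k)

end ChainComplexMatrices

/-! ### The equivariant criterion. -/

theorem proposition4p3 {N : ℕ} {G : Type*} [Group G]
    (ρ : Representation ℂ G (Fin N → ℂ))
    -- the action has finitely many orbits, with representatives `pt 0, …, pt t`
    (t : ℕ) (pt : Fin (t + 1) → (Fin N → ℂ))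
    (hpt : ∀ v : Fin N → ℂ, ∃! j, v ∈ orbitOf ρ (pt j))
    -- `p` is a representative of the generic (dense) orbit
    (p : Fin N → ℂ) (hp : zariskiClosure (orbitOf ρ p) = Set.univ)
    (n : ℕ) (F : EquivariantComplex.{u} ρ n) (hmin : F.IsMinimal)
    (hd : ∀ k, 1 ≤ k → k ≤ n → F.diff k ≠ 0) :
    F.IsExact ↔
      ∀ k, 1 ≤ k → k ≤ n →
        Module.finrank (CoordRing N) (F.cx.X k) =
            rankAt (F.diff k) p + rankAt (F.diff (k + 1)) p ∧
        (k : ℕ∞) ≤ sInf {c : ℕ∞ | ∃ j, rankAt (F.diff k) (pt j) < rankAt (F.diff k) p ∧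
            c = codim (zariskiClosure (orbitOf ρ (pt j)))} := by
  choose r b hb using fun k => (F.gradedFree k).exists_basis
  set D := differentialMatrix F.cx b
  have hD : ∀ k, D k * D (k + 1) = 0 := differentialMatrix_mul F.cx b
  have hr : ∀ k, Module.finrank (CoordRing N) (F.cx.X k) = r k := fun k => by
    rw [Module.finrank_eq_card_basis (b k), Fintype.card_fin]
  have hr0 : ∀ k, n < k → r k = 0 := fun k hk => by
    have := ModuleCat.subsingleton_of_isZero (F.isZero k hk)
    rw [← hr, Module.finrank_zero_of_subsingleton]
  have hinv : ∀ k, IsOrbitInvariant ρ (D k) := fun k =>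
    isOrbitInvariant_toMatrix (b (k + 1)) (b k) _ (F.act (k + 1)) (F.act k)
      (F.act_smul (k + 1)) (F.act_smul k) (F.d_act (k + 1) k)
  have hrank : ∀ k q, rankAt (F.diff (k + 1)) q = pointRank (D k) q := fun k q =>
    rankAt_eq_pointRank (b (k + 1)) (b k) (F.cx.d (k + 1) k).hom q
  have hgen : ∀ k, rankAt (F.diff (k + 1)) p = residueRank ⊥ (D k) := fun k => by
    rw [hrank, (hinv k).pointRank_of_dense hp]
  have hchain : HasRegularChains (CoordRing N) := .mvPolynomial ℂ N
  rw [EquivariantComplex.IsExact, exactAt_iff_matrixExact F.cx b]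
  constructor
  · intro hex k hk hkn
    obtain ⟨k, rfl⟩ : ∃ k', k = k' + 1 := ⟨k - 1, by omega⟩
    refine ⟨by rw [hr, hgen, hgen, hex.residueRank_add hD], le_sInf ?_⟩
    rintro c ⟨j, hj, rfl⟩
    rw [hgen, hrank] at hj
    by_contra! hlt
    obtain ⟨m, hm⟩ := ENat.ne_top_iff_exists.1 hlt.ne_top
    rw [← hm, Nat.cast_lt] at hlt
    -- A prime over the ideal of the orbit with the same height, at most `k`: there `D k` has
    -- generic rank, so a minor of that size is outside `P` and cannot vanish on the whole orbit.
    obtain ⟨P, hP, hle, hPm⟩ := Ideal.exists_isPrime_height_eq hm.symm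
    obtain ⟨h, hh, hc⟩ := hchain P hP
    obtain rfl : h = m := by exact_mod_cast hh.symm.trans hPm
    obtain ⟨I, J, hIJ⟩ := exists_minor_notMem
      (hex.residueRank_eq hD hr0 hc (Nat.lt_succ_iff.1 hlt))
    refine hIJ (hle ?_)
    rw [vanishingIdeal_zariskiClosure]
    intro q hq
    by_contra hne
    rw [MvPolynomial.aeval_eq_eval] at hne
    have := le_pointRank hne
    rw [(hinv k).pointRank_eq hq] at this
    omega
  · intro H
    refine MatrixExact.of_residueRank hchain hD hr0 (fun k hk => ?_) fun k hk P hP hPk => ?_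
    · have := (H (k + 1) (by omega) hk).1
      rw [hr, hgen, hgen] at this
      exact this.symm
    · refine le_antisymm (residueRank_anti bot_le _) ?_
      obtain ⟨q, hq, hle⟩ := (hinv k).exists_le_pointRank (fun v => (hpt v).exists)
        (r := residueRank ⊥ (D k)) (P := P) fun j hj => by
          -- The shift `D k = d_{k+1}` makes this strict: height at most `k`, codimension at least
          -- `k + 1`.
          refine hPk.trans_lt (lt_of_lt_of_le ?_ ((H (k + 1) (by omega) hk).2.trans
            (sInf_le ⟨j, by rwa [hgen, hrank], rfl⟩)))
          exact_mod_cast Nat.lt_succ_self k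
      exact hle.trans (pointRank_le_residueRank _ hq)
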